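/- Let $K\ge 1$ be an integer and let $g$ be a function with $g(x)\in[0,1]$ for $x\in[0,K]$ that is $K$ times continuously differentiable on $(0,K)$. For integers $N\ge K$ and $T\ge 1$ consider the following game with $N$ arms and $T$ periods. In period $t=1,\dots,T$ an adaptive adversary $\mathcal A$ draws a hidden vector $v_t\in[0,1]^N$ from a law depending (measurably) on the past $(v_\tau,S_\tau,r_\tau)_{\tau<t}$; independently of $v_t$ given the past, a randomized policy $\pi$ draws $S_t\subseteq\{1,\dots,N\}$ with $|S_t|=K$ from a law depending only on the past $(S_\tau,r_\tau)_{\tau<t}$; and the policy then observes $r_t\in\{0,1\}$, which given the past, $v_t$ and $S_t$ is $\mathrm{Bernoulli}\big(g(\sum_{i\in S_t}v_{ti})\big)$. Put $R(S,v)=g(\sum_{i\in S}v_i)$ and define the minimax regret $$\mathfrak R(g,N,K,T)=\inf_{\pi}\sup_{\mathcal A}\max_{|S^\star|=K}\mathbb E\Big[\sum_{t=1}^T R(S^\star,v_t)-R(S_t,v_t)\Big],$$ where $\pi$ may depend on $g,N,K,T$. (i) If $g$ coincides on $[0,K]$ with a polynomial of degree exactly $d$, where $1\le d<K$, then there is a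 constant $c_{g,d,K}>0$, depending only on $g,d,K$, such that for all $N>K$ and $T\ge1$ $$\mathfrak R(g,N,K,T)\ge c_{g,d,K}\min\{T,\sqrt{N^dT}\}.$$ (ii) If $g$ does not coincide on $[0,K]$ with any polynomial of degree less than $K$, then there is a constant $c_{g,K}>0$, depending only on $g,K$, such that for all $N>K$ and $T\ge1$ $$\mathfrak R(g,N,K,T)\ge c_{g,K}\min\{T,\sqrt{N^KT}\}.$$ -/

import Mathlib

open MeasureTheory ProbabilityTheory

namespace CombBandit

/-- A link function for subsets of size `K`: a real function that takes values in `[0, 1]` on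
`[0, K]`, the range of the sums `∑ i ∈ S, v i`, and is `K` times continuously differentiable on
`(0, K)`.  Nothing is required at, or of its values at, any other point. -/
structure LinkFunction (K : ℕ) where
  /-- the underlying function -/
  toFun : ℝ → ℝ
  mem_unitInterval : ∀ x ∈ Set.Icc (0 : ℝ) K, toFun x ∈ Set.Icc (0 : ℝ) 1
  contDiffOn : ContDiffOn ℝ K toFun (Set.Ioo (0 : ℝ) K)

/-- `f` coincides on `[0, K]` with a real polynomial of degree exactly `d`. -/
def IsPolynomialOfDegree (f : ℝ → ℝ) (K d : ℕ) : Prop :=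
  ∃ p : Polynomial ℝ, p.degree = d ∧ ∀ x ∈ Set.Icc (0 : ℝ) K, f x = p.eval x

/-- The actions: subsets of the `N` arms with exactly `K` elements. -/
abbrev Action (N K : ℕ) : Type := {S : Finset (Fin N) // S.card = K}

/-- The vectors `v ∈ [0, 1]^N`. -/
abbrev RewardVector (N : ℕ) : Type := Fin N → unitInterval

/-- What the learner sees in one period: the chosen action and the binary feedback
(`true` stands for `1`). -/
abbrev Observation (N K : ℕ) : Type := Action N K × Bool

/-- Everything that happens in one period: the hidden vector, the action and the feedback. -/
abbrev Round (N K : ℕ) : Type := RewardVector N × Observation N K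

/-- Histories of the first `t` periods as seen by the learner. -/
abbrev ObsHistory (N K t : ℕ) : Type := Fin t → Observation N K

/-- Complete histories of the first `t` periods. -/
abbrev History (N K t : ℕ) : Type := Fin t → Round N K

/-- The observable part of a history. -/
def History.obs {N K t : ℕ} (h : History N K t) : ObsHistory N K t := fun s => (h s).2

lemma History.measurable_obs {N K t : ℕ} : Measurable (History.obs (N := N) (K := K) (t := t)) :=
  measurable_pi_lambda _ fun s => measurable_snd.comp (measurable_pi_apply s)

/-- A randomized policy: in each period the law of the next action is a function of the past
actions and feedbacks. -/
structure Policy (N K : ℕ) where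
  /-- the law of the action played after `t` periods -/
  act : ∀ t : ℕ, Kernel (ObsHistory N K t) (Action N K)
  isMarkov : ∀ t, IsMarkovKernel (act t)

/-- A randomized adaptive adversary: in each period the law of the next hidden vector is a
(measurable) function of the past actions, feedbacks and hidden vectors. -/
structure Adversary (N K : ℕ) where
  /-- the law of the vector chosen after `t` periods -/
  choose : ∀ t : ℕ, Kernel (History N K t) (RewardVector N)
  isMarkov : ∀ t, IsMarkovKernel (choose t)

attribute [instance] Policy.isMarkov Adversary.isMarkov

namespace LinkFunction

variable {K N : ℕ}

lemma sum_mem (S : Action N K) (v : RewardVector N) :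
    ∑ i ∈ S.1, (v i : ℝ) ∈ Set.Icc (0 : ℝ) K := by
  refine ⟨Finset.sum_nonneg fun i _ => (v i).2.1, ?_⟩
  calc ∑ i ∈ S.1, (v i : ℝ) ≤ ∑ _i ∈ S.1, (1 : ℝ) := Finset.sum_le_sum fun i _ => (v i).2.2
    _ = K := by simp [S.2]

/-- The mean reward `R(S, v) = g (∑ i ∈ S, v i)`, as an element of `[0, 1]`. -/
def reward (g : LinkFunction K) (S : Action N K) (v : RewardVector N) : unitInterval :=
  ⟨g.toFun (∑ i ∈ S.1, (v i : ℝ)), g.mem_unitInterval _ (sum_mem S v)⟩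

lemma measurable_reward (g : LinkFunction K) (S : Action N K) :
    Measurable fun v : RewardVector N => g.reward S v := by
  classical
  refine Measurable.subtype_mk ?_
  let G : ℝ → ℝ := fun x =>
    if x = 0 then g.toFun 0 else if x = K then g.toFun K
      else (Set.Ioo (0 : ℝ) K).indicator g.toFun x
  have hind : Measurable ((Set.Ioo (0 : ℝ) K).indicator g.toFun) := by
    rw [← Set.piecewise_eq_indicator]
    exact g.contDiffOn.continuousOn.measurable_piecewise continuousOn_const measurableSet_Ioo
  have hG : Measurable G :=
    Measurable.ite (measurableSet_singleton (0 : ℝ)) measurable_const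
      (Measurable.ite (measurableSet_singleton (K : ℝ)) measurable_const hind)
  have hsum : Measurable fun v : RewardVector N => ∑ i ∈ S.1, (v i : ℝ) :=
    Finset.measurable_fun_sum _ fun i _ => measurable_subtype_coe.comp (measurable_pi_apply i)
  have heq : (fun v : RewardVector N => g.toFun (∑ i ∈ S.1, (v i : ℝ)))
      = fun v => G (∑ i ∈ S.1, (v i : ℝ)) := by
    funext v
    obtain ⟨h0, h1⟩ := sum_mem S v
    generalize ∑ i ∈ S.1, (v i : ℝ) = x at h0 h1
    by_cases hx0 : x = 0
    · simp [G, hx0]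
    · by_cases hx1 : x = K
      · subst hx1
        simp [G, hx0]
      · have hx : x ∈ Set.Ioo (0 : ℝ) K :=
          ⟨lt_of_le_of_ne h0 (Ne.symm hx0), lt_of_le_of_ne h1 hx1⟩
        simp only [G, hx0, hx1, if_false, Set.indicator_of_mem hx]
  rw [heq]
  exact hG.comp hsum

lemma measurable_bernoulliMeasure :
    Measurable fun p : unitInterval => bernoulliMeasure true false p := by
  refine Measure.measurable_of_measurable_coe _ fun s _ => ?_
  simp only [bernoulliMeasure_def, Measure.coe_add, Pi.add_apply, Measure.smul_apply]
  have h1 : Measurable unitInterval.toNNReal := unitInterval.toNNReal_continuous.measurable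
  have h2 : Measurable fun p : unitInterval => unitInterval.toNNReal (unitInterval.symm p) :=
    h1.comp unitInterval.continuous_symm.measurable
  exact (h1.coe_nnreal_ennreal.mul_const _).add (h2.coe_nnreal_ennreal.mul_const _)

/-- The law of the feedback given the hidden vector `v` and the action `S`:
Bernoulli with parameter `R(S, v)`. -/
noncomputable def feedback (g : LinkFunction K) (N : ℕ) :
    Kernel (RewardVector N × Action N K) Bool where
  toFun x := bernoulliMeasure true false (g.reward x.2 x.1)
  measurable' := measurable_bernoulliMeasure.comp
    (measurable_from_prod_countable_left fun S => g.measurable_reward S)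

/-- The law of period `t` given the complete history: the hidden vector and the action are drawn
independently given the past, then the feedback is drawn. -/
noncomputable def roundKernel (g : LinkFunction K) (π : Policy N K) (A : Adversary N K) (t : ℕ) :
    Kernel (History N K t) (Round N K) :=
  ((A.choose t ×ₖ (π.act t).comap History.obs History.measurable_obs) ⊗ₖ
    (g.feedback N).prodMkLeft (History N K t)).map
      fun x : (RewardVector N × Action N K) × Bool => (x.1.1, (x.1.2, x.2))

/-- The law of the complete history of the first `t` periods. -/
noncomputable def law (g : LinkFunction K) (π : Policy N K) (A : Adversary N K) :
    (t : ℕ) → Measure (History N K t)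
  | 0 => Measure.dirac Fin.elim0
  | t + 1 => (law g π A t ⊗ₘ g.roundKernel π A t).map
      fun x : History N K t × Round N K => (Fin.snoc x.1 x.2 : History N K (t + 1))

instance (g : LinkFunction K) : IsMarkovKernel (g.feedback N) :=
  ⟨fun x => by change IsProbabilityMeasure (bernoulliMeasure true false _); infer_instance⟩

instance (g : LinkFunction K) (π : Policy N K) (A : Adversary N K) (t : ℕ) :
    IsMarkovKernel (g.roundKernel π A t) := by
  unfold roundKernel
  exact Kernel.IsMarkovKernel.map _ (by fun_prop)

lemma measurable_snoc (t : ℕ) : Measurable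
    fun x : History N K t × Round N K => (Fin.snoc x.1 x.2 : History N K (t + 1)) := by
  refine measurable_pi_lambda _ fun i => ?_
  refine Fin.lastCases ?_ (fun j => ?_) i
  · simpa using measurable_snd
  · simp only [Fin.snoc_castSucc]
    exact (measurable_pi_apply j).comp measurable_fst

instance (g : LinkFunction K) (π : Policy N K) (A : Adversary N K) (t : ℕ) :
    IsProbabilityMeasure (g.law π A t) := by
  induction t with
  | zero => unfold law; infer_instance
  | succ t ih => unfold law; exact Measure.isProbabilityMeasure_map (measurable_snoc t).aemeasurable

/-- The expected regret against the fixed action `Sstar` over `T` periods,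
`𝔼 [∑ t, (R(Sstar, v_t) - R(S_t, v_t))]`.  The integrand is bounded by `T`. -/
noncomputable def expectedRegret (g : LinkFunction K) (T : ℕ) (π : Policy N K)
    (A : Adversary N K) (Sstar : Action N K) : ℝ :=
  ∫ h, ∑ t : Fin T, ((g.reward Sstar (h t).1 : ℝ) - (g.reward (h t).2.1 (h t).1 : ℝ))
    ∂(g.law π A T)

/-- The minimax regret: infimum over policies of the supremum over adversaries of the maximum over
the benchmark action.  It is taken in the extended reals, so that infimum and supremum are the true
ones. -/
noncomputable def minimaxRegret (g : LinkFunction K) (N T : ℕ) : EReal :=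
  ⨅ π : Policy N K, ⨆ A : Adversary N K, ⨆ Sstar : Action N K,
    (g.expectedRegret T π A Sstar : EReal)

end LinkFunction

end CombBandit

/-!
The adversary hides a structure that is visible only to actions that hit it completely. In every
period it draws the bits of all arms as independent fair coins, except that the parity of the bits
in a hidden set `D` of `d ≤ K` arms gets a small bias (`parityLaw`), and gives an arm the value `a`
or `b` according to its bit. Any bits that do not include all of `D` are exactly fair and independent, so
the mean reward of an action is the same constant `q₀` unless the action contains `D`; in that case
it changes by the bias times a number `Γ` that depends only on `g`, `d`, `K`, `a` and `b`
(`LinkFunction.meanReward_parityLaw`). Up to a power of `2`, `Γ` is an average of differences of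
order `d` of `g` with step `b - a`.

For a polynomial of degree `d` these differences are a non-zero constant if `a = 0` and `b = 1`
(`avgOp_diffOp_polynomial_ne_zero`). For `d = K`, some choice of `a` and `b` makes `Γ` non-zero
unless all differences of order `K` with equally spaced nodes in `[0, K]` vanish, and this happens
only for polynomials of degree less than `K` (`LinkFunction.exists_diffOp_ne_zero`).

What remains is a Bernoulli bandit (`integral_law_iid_obs`) in which `N.choose d` hypotheses have to
be searched and an action tests the fraction `ρ = K.choose d / N.choose d` of them. If no action
were better than the others, some `D` would be hit in at most `T ρ` rounds on average, and the
relative entropy between this situation and the one with gap `ε` at `D` would be of order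
`ε² T ρ`. By a form of Pinsker's inequality the policy still misses `D` in a constant fraction of
the rounds if `ε` is a small multiple of `min 1 (T ρ)^(-1/2)` (`exists_histExp_count_le`), and then
its regret is of order `ε T`. The fraction `ρ` is at most `K / (K + 1)` because `K < N`, and it is
of order `N^(-d)`.
-/

namespace CombBandit

/-! ### Averages over the discrete cube -/

/-- The Rademacher variable attached to a bit. -/
def bitSign (x : Bool) : ℝ := cond x 1 (-1)

/-- The value of an arm whose bit is `x`: the arm has value `b` if `x` is set and `a` otherwise. -/
def bitValue (a b : ℝ) (x : Bool) : ℝ := cond x b a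

@[simp] lemma bitSign_true : bitSign true = 1 := rfl

@[simp] lemma bitSign_false : bitSign false = -1 := rfl

@[simp] lemma bitValue_true (a b : ℝ) : bitValue a b true = b := rfl

@[simp] lemma bitValue_false (a b : ℝ) : bitValue a b false = a := rfl

lemma prod_bitSign_update_of_notMem {ι : Type*} [DecidableEq ι] {D : Finset ι} {i : ι} (hi : i ∉ D)
    (x : ι → Bool) (r : Bool) :
    ∏ j ∈ D, bitSign (Function.update x i r j) = ∏ j ∈ D, bitSign (x j) :=
  Finset.prod_congr rfl fun j hj => by
    rw [Function.update_of_ne (ne_of_mem_of_not_mem hj hi)]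

lemma sum_bitValue_update_of_notMem {ι : Type*} [DecidableEq ι] {D : Finset ι} {i : ι} (hi : i ∉ D)
    (a b : ℝ) (x : ι → Bool) (r : Bool) :
    ∑ j ∈ D, bitValue a b (Function.update x i r j) = ∑ j ∈ D, bitValue a b (x j) :=
  Finset.sum_congr rfl fun j hj => by
    rw [Function.update_of_ne (ne_of_mem_of_not_mem hj hi)]

lemma abs_prod_bitSign {ι : Type*} (D : Finset ι) (x : ι → Bool) : |∏ i ∈ D, bitSign (x i)| = 1 := by
  rw [Finset.abs_prod]
  refine Finset.prod_eq_one fun i _ => ?_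
  cases x i <;> simp [bitSign]

section Cube

variable {ι : Type*} [Fintype ι] [DecidableEq ι]

/-- The average of `f` over the cube `ι → Bool`, that is, its expectation under independent fair
bits. -/
noncomputable def cubeAvg (f : (ι → Bool) → ℝ) : ℝ :=
  (∑ x, f x) / 2 ^ Fintype.card ι

/-- Averaging `F` over one more arm with a fair bit. -/
noncomputable def avgOp (a b : ℝ) (F : ℝ → ℝ) (c : ℝ) : ℝ := (F (c + b) + F (c + a)) / 2

/-- Averaging `F` over one more arm with a fair bit, weighted by the sign of the bit. -/
noncomputable def diffOp (a b : ℝ) (F : ℝ → ℝ) (c : ℝ) : ℝ := (F (c + b) - F (c + a)) / 2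

lemma cubeAvg_add (f f' : (ι → Bool) → ℝ) :
    cubeAvg (fun x => f x + f' x) = cubeAvg f + cubeAvg f' := by
  simp [cubeAvg, Finset.sum_add_distrib, add_div]

lemma cubeAvg_const_mul (c : ℝ) (f : (ι → Bool) → ℝ) :
    cubeAvg (fun x => c * f x) = c * cubeAvg f := by
  simp [cubeAvg, ← Finset.mul_sum, mul_div_assoc]

lemma cubeAvg_const (c : ℝ) : cubeAvg (fun _ : ι → Bool => c) = c := by
  simp [cubeAvg]

/-- The bit `i` may be averaged out first. -/
lemma cubeAvg_update (i : ι) (f : (ι → Bool) → ℝ) :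
    cubeAvg f = cubeAvg fun x =>
      (f (Function.update x i true) + f (Function.update x i false)) / 2 := by
  have hinv : Function.Involutive fun x : ι → Bool => Function.update x i (!x i) := fun x => by
    simp
  have hflip : ∑ x : ι → Bool, f (Function.update x i (!x i)) = ∑ x, f x :=
    Equiv.sum_comp (Function.Involutive.toPerm _ hinv) f
  have hpair : ∀ x : ι → Bool, f (Function.update x i true) + f (Function.update x i false) =
      f x + f (Function.update x i (!x i)) := fun x => by
    have hx : f x = f (Function.update x i (x i)) := by simp
    rw [hx]
    cases x i <;> simp [add_comm]
  simp only [cubeAvg, hpair]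
  rw [← Finset.sum_div, Finset.sum_add_distrib, hflip]
  ring

lemma cubeAvg_sum_bitValue (a b : ℝ) (E : Finset ι) (F : ℝ → ℝ) (c : ℝ) :
    cubeAvg (fun x => F (c + ∑ i ∈ E, bitValue a b (x i))) = (avgOp a b)^[E.card] F c := by
  induction E using Finset.induction_on generalizing F with
  | empty => simp [cubeAvg_const]
  | insert i E hi ih =>
    rw [Finset.card_insert_of_notMem hi, Function.iterate_succ_apply, ← ih, cubeAvg_update i]
    congr 1
    funext x
    simp only [Finset.sum_insert hi, sum_bitValue_update_of_notMem hi, Function.update_self,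
      avgOp, bitValue_true, bitValue_false]
    ring_nf

/-- The correlation of the parity of the bits in `D` with a function of the total value of
`D ∪ E`. -/
lemma cubeAvg_parity_mul (a b : ℝ) {D E : Finset ι} (hDE : Disjoint D E) (F : ℝ → ℝ) (c : ℝ) :
    cubeAvg (fun x => (∏ i ∈ D, bitSign (x i)) * F (c + ∑ i ∈ D ∪ E, bitValue a b (x i)))
      = (avgOp a b)^[E.card] ((diffOp a b)^[D.card] F) c := by
  induction D using Finset.induction_on generalizing F with
  | empty => simpa using cubeAvg_sum_bitValue a b E F c
  | insert i D hi ih =>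
    rw [Finset.disjoint_insert_left] at hDE
    have hiU : i ∉ D ∪ E := by simp [hi, hDE.1]
    rw [Finset.card_insert_of_notMem hi, Function.iterate_succ_apply, ← ih hDE.2,
      cubeAvg_update i]
    congr 1
    funext x
    simp only [Finset.insert_union, Finset.sum_insert hiU, Finset.prod_insert hi,
      sum_bitValue_update_of_notMem hiU, prod_bitSign_update_of_notMem hi, Function.update_self,
      diffOp, bitValue_true, bitValue_false, bitSign_true, bitSign_false]
    ring_nf

/-- The parity of the bits in `D` is uncorrelated with every function of the bits in a set that
misses one element of `D`. -/
lemma cubeAvg_parity_mul_eq_zero (a b : ℝ) {D S : Finset ι} (h : ¬ D ⊆ S) (F : ℝ → ℝ) :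
    cubeAvg (fun x => (∏ i ∈ D, bitSign (x i)) * F (∑ i ∈ S, bitValue a b (x i))) = 0 := by
  obtain ⟨i, hiD, hiS⟩ := Finset.not_subset.1 h
  rw [cubeAvg_update i, ← cubeAvg_const (ι := ι) 0]
  congr 1
  funext x
  rw [← Finset.insert_erase hiD]
  simp only [Finset.prod_insert (Finset.notMem_erase i D),
    prod_bitSign_update_of_notMem (Finset.notMem_erase i D),
    sum_bitValue_update_of_notMem hiS, Function.update_self, bitSign_true, bitSign_false]
  ring

end Cube

/-! ### Finite differences -/

lemma avgOp_iterate_const (a b k : ℝ) (n : ℕ) (c : ℝ) :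
    (avgOp a b)^[n] (fun _ => k) c = k := by
  have : avgOp a b (fun _ => k) = fun _ => k := by funext c; simp [avgOp]
  induction n with
  | zero => rfl
  | succ n ih => rw [Function.iterate_succ_apply, this, ih]

lemma diffOp_iterate (a b : ℝ) (n : ℕ) (F : ℝ → ℝ) (c : ℝ) :
    (diffOp a b)^[n] F c = (fwdDiff (b - a))^[n] F (c + n * a) / 2 ^ n := by
  induction n generalizing c with
  | zero => simp
  | succ n ih =>
    rw [Function.iterate_succ_apply', Function.iterate_succ_apply', diffOp, ih, ih, fwdDiff]
    push_cast
    rw [show c + (n + 1) * a + (b - a) = c + b + n * a by ring,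
      show c + (n + 1) * a = c + a + n * a by ring]
    ring

lemma natDegree_lt_of_degree_lt {q : Polynomial ℝ} {K : ℕ} (hK : 0 < K) (hq : q.degree < K) :
    q.natDegree < K := by
  rcases eq_or_ne q 0 with rfl | h
  · simpa using hK
  · exact (Polynomial.natDegree_lt_iff_degree_lt h).2 hq

/-- A sequence `F 0, …, F n` whose differences of order `K` vanish is given by a polynomial of
degree less than `K`. -/
lemma exists_polynomial_of_fwdDiff_eq_zero {K n : ℕ} (F : ℝ → ℝ)
    (h : ∀ j : ℕ, j + K ≤ n → (fwdDiff (1 : ℝ))^[K] F j = 0) :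
    ∃ q : Polynomial ℝ, q.degree < K ∧ ∀ j : ℕ, j ≤ n → F j = q.eval (j : ℝ) := by
  have hinj : Set.InjOn (fun i : ℕ => (i : ℝ)) (Finset.range K) := Nat.cast_injective.injOn
  let q := Lagrange.interpolate (Finset.range K) (fun i : ℕ => (i : ℝ)) (fun i : ℕ => F i)
  have hq : q.degree < K := by
    simpa only [Finset.card_range] using Lagrange.degree_interpolate_lt (fun i : ℕ => F i) hinj
  refine ⟨q, hq, fun j => ?_⟩
  induction j using Nat.strong_induction_on with
  | _ j ih =>
    intro hj
    by_cases hjK : j < K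
    · exact (Lagrange.eval_interpolate_at_node (fun i : ℕ => F i) hinj
        (Finset.mem_range.2 hjK)).symm
    · obtain ⟨i, rfl⟩ := Nat.exists_eq_add_of_le' (not_lt.1 hjK)
      have hF := h i hj
      have hQ : (fwdDiff (1 : ℝ))^[K] q.eval i = 0 := by
        rcases K.eq_zero_or_pos with rfl | hK
        · have : q = 0 := by simpa using hq
          simp [this]
        · rw [Polynomial.fwdDiff_iter_eq_zero_of_degree_lt
            (natDegree_lt_of_degree_lt hK hq)]
          rfl
      rw [fwdDiff_iter_eq_sum_shift, Finset.sum_range_succ] at hF hQ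
      have hlow : ∑ k ∈ Finset.range K, ((-1 : ℤ) ^ (K - k) * K.choose k) • F (i + k • (1 : ℝ))
          = ∑ k ∈ Finset.range K, ((-1 : ℤ) ^ (K - k) * K.choose k) • q.eval (i + k • (1 : ℝ)) :=
        Finset.sum_congr rfl fun k hk => by
          have hk := Finset.mem_range.1 hk
          have := ih (i + k) (by omega) (by omega)
          push_cast at this
          simp only [nsmul_eq_mul, mul_one, this]
      rw [hlow] at hF
      simp only [Nat.sub_self, pow_zero, Nat.choose_self, Nat.cast_one, mul_one, one_smul,
        nsmul_eq_mul] at hF hQ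
      push_cast
      linarith

lemma fwdDiff_iterate_comp_div (f : ℝ → ℝ) (m : ℝ) (n : ℕ) (x : ℝ) :
    (fwdDiff (1 : ℝ))^[n] (fun t => f (t / m)) x = (fwdDiff (1 / m))^[n] f (x / m) := by
  simp only [fwdDiff_iter_eq_sum_shift, nsmul_eq_mul]
  refine Finset.sum_congr rfl fun k _ => ?_
  rw [show (x + k * 1) / m = x / m + k * (1 / m) by ring]

/-- A link function all of whose differences of order `K` with equally spaced nodes in `[0, K]`
vanish is a polynomial of degree less than `K`: on each grid `ℤ / m` it agrees with such a
polynomial, the values at `0, …, K - 1` show that it is the same one for all `m`, and continuity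
does the rest. -/
lemma LinkFunction.exists_diffOp_ne_zero {K : ℕ} (hK : 1 ≤ K) (g : LinkFunction K)
    (hg : ¬ ∃ p : Polynomial ℝ, p.degree < K ∧ ∀ x ∈ Set.Icc (0 : ℝ) K, g.toFun x = p.eval x) :
    ∃ a b : unitInterval, (diffOp a b)^[K] g.toFun 0 ≠ 0 := by
  by_contra! hzero
  have hK0 : (0 : ℝ) < K := by exact_mod_cast hK
  have hgrid : ∀ m : ℕ, 1 ≤ m → ∃ q : Polynomial ℝ, q.degree < K ∧
      ∀ j : ℕ, j ≤ K * m → g.toFun ((j : ℝ) / m) = q.eval ((j : ℝ) / m) := by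
    intro m hm
    have hm0 : (0 : ℝ) < m := by exact_mod_cast hm
    obtain ⟨q, hq, hqe⟩ := exists_polynomial_of_fwdDiff_eq_zero (K := K) (n := K * m)
      (fun t => g.toFun (t / m)) fun j hj => by
        have hj' : (j : ℝ) + K ≤ K * m := by exact_mod_cast hj
        have hb : ((j : ℝ) + K) / (K * m) ≤ 1 := (div_le_one (by positivity)).2 hj'
        have ha : (j : ℝ) / (K * m) ≤ 1 :=
          (div_le_one (by positivity)).2 (by linarith)
        have := hzero ⟨(j : ℝ) / (K * m), by positivity, ha⟩
          ⟨((j : ℝ) + K) / (K * m), by positivity, hb⟩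
        rw [diffOp_iterate, div_eq_zero_iff, or_iff_left (by positivity)] at this
        rw [fwdDiff_iterate_comp_div, ← this]
        rw [show ((j : ℝ) + K) / (K * m) - j / (K * m) = 1 / m by field_simp; ring,
          show (0 : ℝ) + K * (j / (K * m)) = j / m by field_simp; ring]
    refine ⟨q.comp (Polynomial.C (m : ℝ) * Polynomial.X), ?_, fun j hj => ?_⟩
    · refine Polynomial.degree_le_natDegree.trans_lt (Nat.cast_lt.2 ?_)
      rw [Polynomial.natDegree_comp, Polynomial.natDegree_C_mul_X _ hm0.ne', mul_one]
      exact natDegree_lt_of_degree_lt hK hq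
    · simpa [mul_div_cancel₀ _ hm0.ne'] using hqe j hj
  obtain ⟨p, hp, hpe⟩ := hgrid 1 le_rfl
  simp only [Nat.cast_one, div_one, mul_one] at hpe
  have hgridp : ∀ m : ℕ, 1 ≤ m → ∀ j : ℕ, j ≤ K * m →
      g.toFun ((j : ℝ) / m) = p.eval ((j : ℝ) / m) := by
    intro m hm j hj
    have hm0 : (0 : ℝ) < m := by exact_mod_cast hm
    obtain ⟨q, hq, hqe⟩ := hgrid m hm
    have hpq : p = q := by
      refine Polynomial.eq_of_degrees_lt_of_eval_index_eq (Finset.range K)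
        (v := fun i : ℕ => (i : ℝ)) Nat.cast_injective.injOn
        (by simpa using hp) (by simpa using hq) fun i hi => ?_
      have hi := (Finset.mem_range.1 hi).le
      have h2 := hqe (i * m) (Nat.mul_le_mul_right m hi)
      push_cast at h2
      rw [mul_div_cancel_right₀ _ hm0.ne'] at h2
      rw [← hpe i hi, h2]
    rw [hpq]
    exact hqe j hj
  have hrat : ∀ x : ℚ, 0 ≤ x → x ≤ K → g.toFun x = p.eval (x : ℝ) := by
    intro x hx0 hxK
    have hden : (0 : ℚ) < x.den := by exact_mod_cast x.pos
    have hxn : (x : ℝ) = (x.num.toNat : ℝ) / x.den := by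
      have hn : ((x.num.toNat : ℤ) : ℝ) = (x.num : ℝ) := by
        rw [Int.toNat_of_nonneg (Rat.num_nonneg.2 hx0)]
      rw [← Int.cast_natCast x.num.toNat, hn]
      exact Rat.cast_def x
    rw [hxn]
    refine hgridp x.den x.pos _ ?_
    have hxK' : (x : ℝ) ≤ K := by exact_mod_cast hxK
    rw [hxn, div_le_iff₀ (by exact_mod_cast x.pos)] at hxK'
    exact_mod_cast hxK'
  refine hg ⟨p, hp, fun x hx => ?_⟩
  have hIoo : Set.EqOn g.toFun (fun x => p.eval x) (Set.Ioo (0 : ℝ) K) := by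
    refine Set.EqOn.of_subset_closure (s := Set.Ioo (0 : ℝ) K ∩ Set.range ((↑) : ℚ → ℝ)) ?_
      g.contDiffOn.continuousOn p.continuous.continuousOn Set.inter_subset_left
      (Rat.denseRange_cast.open_subset_closure_inter isOpen_Ioo)
    rintro _ ⟨⟨h0, h1⟩, y, rfl⟩
    exact hrat y (by exact_mod_cast h0.le) (by exact_mod_cast h1.le)
  rcases hx.1.eq_or_lt with rfl | h0
  · simpa using hrat 0 le_rfl (by positivity)
  · rcases hx.2.eq_or_lt with rfl | h1
    · simpa using hrat K (by positivity) le_rfl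
    · exact hIoo ⟨h0, h1⟩

/-- The difference of order `d` of a polynomial of degree `d` is a non-zero constant, and averaging
does not change it. -/
lemma avgOp_diffOp_polynomial_ne_zero {p : Polynomial ℝ} {d : ℕ} (hp : p.degree = d) (n : ℕ) :
    (avgOp 0 1)^[n] ((diffOp 0 1)^[d] fun x => p.eval x) 0 ≠ 0 := by
  have hnat : p.natDegree = d := Polynomial.natDegree_eq_of_degree_eq_some hp
  have hconst : ((diffOp 0 1)^[d] fun x => p.eval x)
      = fun _ => p.leadingCoeff * (d.factorial : ℝ) / 2 ^ d := by
    funext c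
    have := congrFun p.fwdDiff_iter_degree_eq_factorial (c + d * 0)
    rw [hnat] at this
    rw [diffOp_iterate, sub_zero, this]
    simp
  rw [hconst, avgOp_iterate_const]
  have : p.leadingCoeff ≠ 0 := Polynomial.leadingCoeff_ne_zero.2 fun h => by simp [h] at hp
  positivity

/-! ### Laws of finite action-feedback histories -/

/-- The probability that a Bernoulli variable with mean `p` equals `r`. -/
def bernWeight (p : ℝ) (r : Bool) : ℝ := cond r p (1 - p)

@[simp] lemma bernWeight_true (p : ℝ) : bernWeight p true = p := rfl

@[simp] lemma bernWeight_false (p : ℝ) : bernWeight p false = 1 - p := rfl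

lemma bernWeight_nonneg {p : ℝ} (hp : p ∈ Set.Icc (0 : ℝ) 1) (r : Bool) : 0 ≤ bernWeight p r := by
  cases r
  · simpa using hp.2
  · simpa using hp.1

lemma bernWeight_pos {p : ℝ} (hp : p ∈ Set.Ioo (0 : ℝ) 1) (r : Bool) : 0 < bernWeight p r := by
  cases r
  · simpa using hp.2
  · simpa using hp.1

lemma sum_bernWeight (p : ℝ) : ∑ r, bernWeight p r = 1 := by simp

section History

variable {α : Type*}

/-- The probability of a history of `t` rounds in a bandit problem where the action `S` is played
with probability `p s h S` after the history `h` of `s` rounds, and has Bernoulli feedback with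
mean `q S`. -/
noncomputable def histWeight (p : ∀ t, (Fin t → α × Bool) → α → ℝ) (q : α → ℝ) :
    ∀ t, (Fin t → α × Bool) → ℝ
  | 0, _ => 1
  | t + 1, h => histWeight p q t (Fin.init h) *
      (p t (Fin.init h) (h (Fin.last t)).1 *
        bernWeight (q (h (Fin.last t)).1) (h (Fin.last t)).2)

lemma histWeight_snoc (p : ∀ t, (Fin t → α × Bool) → α → ℝ) (q : α → ℝ) (t : ℕ)
    (h : Fin t → α × Bool) (x : α × Bool) :
    histWeight p q (t + 1) (Fin.snoc h x : Fin (t + 1) → α × Bool)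
      = histWeight p q t h * (p t h x.1 * bernWeight (q x.1) x.2) := by
  simp [histWeight]

lemma histWeight_nonneg {p : ∀ t, (Fin t → α × Bool) → α → ℝ} {q : α → ℝ}
    (hp : ∀ t h S, 0 ≤ p t h S) (hq : ∀ S, q S ∈ Set.Icc (0 : ℝ) 1) (t : ℕ)
    (h : Fin t → α × Bool) : 0 ≤ histWeight p q t h := by
  induction t with
  | zero => exact zero_le_one
  | succ t ih => exact mul_nonneg (ih _) (mul_nonneg (hp _ _ _) (bernWeight_nonneg (hq _) _))

/-- The log-likelihood ratio of the feedbacks of two bandit problems. -/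
noncomputable def logRatio (q q' : α → ℝ) (x : α × Bool) : ℝ :=
  Real.log (bernWeight (q x.1) x.2 / bernWeight (q' x.1) x.2)

/-- The likelihood ratio of the histories does not involve the policy. -/
lemma histWeight_eq_mul_exp (p : ∀ t, (Fin t → α × Bool) → α → ℝ) {q q' : α → ℝ}
    (hq : ∀ S, q S ∈ Set.Ioo (0 : ℝ) 1) (hq' : ∀ S, q' S ∈ Set.Ioo (0 : ℝ) 1) (t : ℕ)
    (h : Fin t → α × Bool) :
    histWeight p q' t h = histWeight p q t h * Real.exp (-∑ s, logRatio q q' (h s)) := by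
  induction t with
  | zero => simp [histWeight]
  | succ t ih =>
    have hb := bernWeight_pos (hq (h (Fin.last t)).1) (h (Fin.last t)).2
    have hb' := bernWeight_pos (hq' (h (Fin.last t)).1) (h (Fin.last t)).2
    have hinit : ∑ s, logRatio q q' (Fin.init h s) = ∑ s : Fin t, logRatio q q' (h s.castSucc) :=
      rfl
    have hlast : Real.exp (-logRatio q q' (h (Fin.last t)))
        = bernWeight (q' (h (Fin.last t)).1) (h (Fin.last t)).2 /
          bernWeight (q (h (Fin.last t)).1) (h (Fin.last t)).2 := by
      rw [logRatio, Real.exp_neg, Real.exp_log (div_pos hb hb'), inv_div]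
    rw [histWeight, histWeight, ih, Fin.sum_univ_castSucc, neg_add, Real.exp_add, hlast, hinit]
    field_simp

variable [Fintype α]

/-- The expectation of a function of the history of `t` rounds. -/
noncomputable def histExp (p : ∀ t, (Fin t → α × Bool) → α → ℝ) (q : α → ℝ) (t : ℕ)
    (F : (Fin t → α × Bool) → ℝ) : ℝ :=
  ∑ h, histWeight p q t h * F h

variable (p : ∀ t, (Fin t → α × Bool) → α → ℝ) (q : α → ℝ)

lemma histExp_succ (t : ℕ) (F : (Fin (t + 1) → α × Bool) → ℝ) :
    histExp p q (t + 1) F = histExp p q t fun h =>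
      ∑ S, p t h S * ∑ r, bernWeight (q S) r * F (Fin.snoc h (S, r) : Fin (t + 1) → α × Bool) := by
  rw [histExp, ← (Fin.snocEquiv fun _ : Fin (t + 1) => α × Bool).sum_comp,
    Fintype.sum_prod_type_right]
  refine Finset.sum_congr rfl fun h _ => ?_
  rw [Fintype.sum_prod_type, Finset.mul_sum]
  refine Finset.sum_congr rfl fun S _ => ?_
  rw [Finset.mul_sum, Finset.mul_sum]
  refine Finset.sum_congr rfl fun r _ => ?_
  have := histWeight_snoc p q t h (S, r)
  simp only [Fin.snocEquiv, Equiv.coe_fn_mk] at this ⊢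
  rw [this]
  ring

lemma histExp_add (t : ℕ) (F G : (Fin t → α × Bool) → ℝ) :
    histExp p q t (fun h => F h + G h) = histExp p q t F + histExp p q t G := by
  simp [histExp, mul_add, Finset.sum_add_distrib]

lemma histExp_sum {ι : Type*} (s : Finset ι) (t : ℕ) (F : ι → (Fin t → α × Bool) → ℝ) :
    histExp p q t (fun h => ∑ i ∈ s, F i h) = ∑ i ∈ s, histExp p q t (F i) := by
  simp only [histExp, Finset.mul_sum]
  exact Finset.sum_comm

lemma histExp_const_mul (t : ℕ) (c : ℝ) (F : (Fin t → α × Bool) → ℝ) :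
    histExp p q t (fun h => c * F h) = c * histExp p q t F := by
  simp only [histExp, Finset.mul_sum]
  exact Finset.sum_congr rfl fun h _ => by ring

variable {p q}

lemma histExp_const (hp1 : ∀ t h, ∑ S, p t h S = 1) (t : ℕ) (c : ℝ) :
    histExp p q t (fun _ => c) = c := by
  induction t with
  | zero => simp [histExp, histWeight]
  | succ t ih => simp only [histExp_succ, ← Finset.sum_mul, sum_bernWeight, hp1, one_mul, ih]

lemma histExp_mono (hp : ∀ t h S, 0 ≤ p t h S) (hq : ∀ S, q S ∈ Set.Icc (0 : ℝ) 1) {t : ℕ}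
    {F G : (Fin t → α × Bool) → ℝ} (hFG : ∀ h, F h ≤ G h) :
    histExp p q t F ≤ histExp p q t G :=
  Finset.sum_le_sum fun h _ => mul_le_mul_of_nonneg_left (hFG h) (histWeight_nonneg hp hq t h)

/-- In an additive functional of the history the feedback may be averaged out. -/
lemma histExp_sum_feedback (hp1 : ∀ t h, ∑ S, p t h S = 1) (t : ℕ) (f : α × Bool → ℝ) :
    histExp p q t (fun h => ∑ s, f (h s))
      = histExp p q t fun h => ∑ s, ∑ r, bernWeight (q (h s).1) r * f ((h s).1, r) := by
  induction t with
  | zero => simp [histExp]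
  | succ t ih =>
    simp only [histExp_succ, Fin.sum_univ_castSucc, Fin.snoc_castSucc, Fin.snoc_last, mul_add,
      Finset.sum_add_distrib, ← Finset.sum_mul, sum_bernWeight, hp1, one_mul, histExp_add, ih]

/-! ### Change of measure -/

/-- A form of Pinsker's inequality: the `L¹` distance between the laws `P` and `P e^{-ℓ}` is
bounded by the square root of their relative entropy `∑ P ℓ`, up to a factor. -/
lemma sum_abs_mul_one_sub_exp_le {Ω : Type*} [Fintype Ω] {P l : Ω → ℝ} (hP : ∀ x, 0 ≤ P x)
    (hP1 : ∑ x, P x = 1) (hQ1 : ∑ x, P x * Real.exp (-l x) = 1) :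
    ∑ x, |P x * Real.exp (-l x) - P x| ≤ 2 * √(∑ x, P x * l x) := by
  -- `u` is the square root of the likelihood ratio, so that `∑ P u` is the Hellinger affinity
  let u : Ω → ℝ := fun x => Real.exp (-(l x / 2))
  have hu0 : ∀ x, 0 ≤ u x := fun x => (Real.exp_pos _).le
  have hu2 : ∀ x, Real.exp (-l x) = u x ^ 2 := fun x => by
    simp only [u, ← Real.exp_nat_mul]
    congr 1
    push_cast
    ring
  have hul : ∀ x, 1 - u x ≤ l x / 2 := fun x => by
    have := Real.add_one_le_exp (-(l x / 2))
    simp only [u]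
    linarith
  simp only [hu2] at hQ1 ⊢
  have hcs : (∑ x, |P x * u x ^ 2 - P x|) ^ 2
      ≤ (∑ x, P x * (1 - u x) ^ 2) * ∑ x, P x * (1 + u x) ^ 2 := by
    refine Finset.sum_sq_le_sum_mul_sum_of_sq_le_mul _
      (fun x _ => mul_nonneg (hP x) (sq_nonneg _)) (fun x _ => mul_nonneg (hP x) (sq_nonneg _))
      fun x _ => le_of_eq ?_
    rw [sq_abs]
    ring
  have hminus : ∑ x, P x * (1 - u x) ^ 2 = 2 - 2 * ∑ x, P x * u x := by
    have : ∀ x, P x * (1 - u x) ^ 2 = P x + P x * u x ^ 2 - 2 * (P x * u x) := fun x => by ring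
    simp only [this, Finset.sum_sub_distrib, Finset.sum_add_distrib, ← Finset.mul_sum, hP1, hQ1]
    norm_num
  have hplus : ∑ x, P x * (1 + u x) ^ 2 = 2 + 2 * ∑ x, P x * u x := by
    have : ∀ x, P x * (1 + u x) ^ 2 = P x + P x * u x ^ 2 + 2 * (P x * u x) := fun x => by ring
    simp only [this, Finset.sum_add_distrib, ← Finset.mul_sum, hP1, hQ1]
    norm_num
  have hm0 : 0 ≤ ∑ x, P x * (1 - u x) ^ 2 :=
    Finset.sum_nonneg fun x _ => mul_nonneg (hP x) (sq_nonneg _)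
  have hent : 2 - 2 * ∑ x, P x * u x ≤ ∑ x, P x * l x := by
    have h1 : ∑ x, P x * (1 - u x) ≤ ∑ x, P x * (l x / 2) :=
      Finset.sum_le_sum fun x _ => mul_le_mul_of_nonneg_left (hul x) (hP x)
    have h2 : ∑ x, P x * (l x / 2) = (∑ x, P x * l x) / 2 := by
      rw [Finset.sum_div]
      exact Finset.sum_congr rfl fun x _ => by ring
    simp only [mul_sub, mul_one, Finset.sum_sub_distrib, hP1] at h1
    linarith
  rw [hminus, hplus] at hcs
  rw [hminus] at hm0
  have hle : (∑ x, |P x * u x ^ 2 - P x|) ^ 2 ≤ 2 ^ 2 * ∑ x, P x * l x := by nlinarith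
  calc _ ≤ √(2 ^ 2 * ∑ x, P x * l x) := Real.le_sqrt_of_sq_le hle
    _ = 2 * √(∑ x, P x * l x) := by
      rw [Real.sqrt_mul (by positivity), Real.sqrt_sq (by positivity)]

/-- The relative entropy of two Bernoulli laws is at most their `χ²` divergence. -/
lemma sum_bernWeight_mul_log_le {q q' : ℝ} (hq : q ∈ Set.Ioo (0 : ℝ) 1)
    (hq' : q' ∈ Set.Ioo (0 : ℝ) 1) :
    ∑ r, bernWeight q r * Real.log (bernWeight q r / bernWeight q' r)
      ≤ (q' - q) ^ 2 / (q' * (1 - q')) := by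
  have h : ∀ r, bernWeight q r * Real.log (bernWeight q r / bernWeight q' r)
      ≤ bernWeight q r * (bernWeight q r / bernWeight q' r - 1) := fun r =>
    mul_le_mul_of_nonneg_left
      (Real.log_le_sub_one_of_pos (div_pos (bernWeight_pos hq r) (bernWeight_pos hq' r)))
      (bernWeight_pos hq r).le
  refine (Finset.sum_le_sum fun r _ => h r).trans_eq ?_
  have h0 : q' ≠ 0 := hq'.1.ne'
  have h1 : 1 - q' ≠ 0 := (sub_pos.2 hq'.2).ne'
  simp only [Fintype.sum_bool, bernWeight_true, bernWeight_false]
  field_simp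
  ring

/-- Changing the mean feedbacks from `q` to `q'` changes the expectation of a function with values
in `[0, B]` by at most a multiple of the square root of the expected information gathered under
`q`. -/
lemma histExp_le_add_sqrt {q' : α → ℝ} (hp : ∀ t h S, 0 ≤ p t h S)
    (hp1 : ∀ t h, ∑ S, p t h S = 1) (hq : ∀ S, q S ∈ Set.Ioo (0 : ℝ) 1)
    (hq' : ∀ S, q' S ∈ Set.Ioo (0 : ℝ) 1) {t : ℕ} {F : (Fin t → α × Bool) → ℝ} {B : ℝ}
    (hF0 : ∀ h, 0 ≤ F h) (hFB : ∀ h, F h ≤ B) :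
    histExp p q' t F ≤ histExp p q t F + B * (2 * √(histExp p q t fun h =>
      ∑ s, (q' (h s).1 - q (h s).1) ^ 2 / (q' (h s).1 * (1 - q' (h s).1)))) := by
  have hIcc : ∀ S, q S ∈ Set.Icc (0 : ℝ) 1 := fun S => Set.Ioo_subset_Icc_self (hq S)
  have hw := histWeight_eq_mul_exp p hq hq' t
  have hB0 : 0 ≤ B := by
    by_cases hne : Nonempty (Fin t → α × Bool)
    · exact (hF0 hne.some).trans (hFB _)
    · have := histExp_const (q := q) hp1 t 1
      rw [not_nonempty_iff] at hne
      simp [histExp] at this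
  have hdiff : histExp p q' t F - histExp p q t F
      ≤ B * ∑ h, |histWeight p q t h * Real.exp (-∑ s, logRatio q q' (h s))
          - histWeight p q t h| := by
    rw [histExp, histExp, ← Finset.sum_sub_distrib, Finset.mul_sum]
    refine Finset.sum_le_sum fun h _ => ?_
    rw [← hw, ← sub_mul, mul_comm]
    exact (mul_le_mul_of_nonneg_left (le_abs_self _) (hF0 h)).trans
      (mul_le_mul_of_nonneg_right (hFB h) (abs_nonneg _))
  have hone : ∀ q : α → ℝ, ∑ h, histWeight p q t h = 1 := fun q => by
    simpa [histExp] using histExp_const (q := q) hp1 t 1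
  have hpinsker := sum_abs_mul_one_sub_exp_le (histWeight_nonneg hp hIcc t) (hone q)
    ((Finset.sum_congr rfl fun h _ => (hw h).symm).trans (hone q'))
  have hent : ∑ h, histWeight p q t h * ∑ s, logRatio q q' (h s)
      ≤ histExp p q t fun h =>
        ∑ s, (q' (h s).1 - q (h s).1) ^ 2 / (q' (h s).1 * (1 - q' (h s).1)) := by
    change histExp p q t (fun h => ∑ s, logRatio q q' (h s)) ≤ _
    rw [histExp_sum_feedback hp1]
    exact histExp_mono hp hIcc fun h => Finset.sum_le_sum fun s _ =>
      sum_bernWeight_mul_log_le (hq _) (hq' _)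
  have := mul_le_mul_of_nonneg_left (hpinsker.trans
    (mul_le_mul_of_nonneg_left (Real.sqrt_le_sqrt hent) zero_le_two)) hB0
  linarith

/-- If every action reveals at most a fraction `ρ` of the possible secrets `D`, then some secret is
missed most of the time: the expected number of rounds in which it is hit remains of order `ρ t`
even if hitting it raises the mean feedback by `ε`, as long as `ε` is small. -/
lemma exists_histExp_count_le {𝒟 : Type*} [Fintype 𝒟] [Nonempty 𝒟] (C : 𝒟 → α → Prop)
    [∀ D, DecidablePred (C D)] (hp : ∀ t h S, 0 ≤ p t h S) (hp1 : ∀ t h, ∑ S, p t h S = 1)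
    {q₀ ε η ρ : ℝ} (hq₀ : q₀ ∈ Set.Ioo (0 : ℝ) 1) (hε : q₀ + ε ∈ Set.Ioo (0 : ℝ) 1)
    (hη : 0 < η) (hηε : η ≤ (q₀ + ε) * (1 - (q₀ + ε)))
    (hρ : ∀ S, ∑ D, (if C D S then (1 : ℝ) else 0) ≤ ρ * Fintype.card 𝒟) (t : ℕ) :
    ∃ D, histExp p (fun S => q₀ + if C D S then ε else 0) t
        (fun h => ∑ s, if C D (h s).1 then (1 : ℝ) else 0)
      ≤ t * (ρ + 2 * √(ε ^ 2 / η * (t * ρ))) := by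
  have hIcc : ∀ _ : α, q₀ ∈ Set.Icc (0 : ℝ) 1 := fun S => Set.Ioo_subset_Icc_self hq₀
  let n : 𝒟 → (Fin t → α × Bool) → ℝ := fun D h => ∑ s, if C D (h s).1 then (1 : ℝ) else 0
  have hn0 : ∀ D h, 0 ≤ n D h := fun D h =>
    Finset.sum_nonneg fun s _ => by split_ifs <;> norm_num
  have hnt : ∀ D h, n D h ≤ t := fun D h => by
    refine (Finset.sum_le_sum (g := fun _ => (1 : ℝ)) fun s _ => ?_).trans (by simp)
    split_ifs <;> norm_num
  -- a secret that is hit as rarely as possible when no action is better than the others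
  obtain ⟨D, -, hD⟩ : ∃ D ∈ Finset.univ, histExp p (fun _ => q₀) t (n D) ≤ t * ρ := by
    refine Finset.exists_le_of_sum_le Finset.univ_nonempty ?_
    rw [← histExp_sum, Finset.sum_const, Finset.card_univ, nsmul_eq_mul]
    refine (histExp_mono (G := fun _ => Fintype.card 𝒟 * (t * ρ)) hp hIcc fun h => ?_).trans_eq
      (histExp_const hp1 t _)
    simp only [n]
    rw [Finset.sum_comm]
    refine (Finset.sum_le_sum fun s _ => hρ (h s).1).trans_eq ?_
    rw [Finset.sum_const, Finset.card_univ, Fintype.card_fin, nsmul_eq_mul]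
    ring
  refine ⟨D, ?_⟩
  have hq' : ∀ S, (q₀ + if C D S then ε else 0) ∈ Set.Ioo (0 : ℝ) 1 := fun S => by
    split_ifs
    · exact hε
    · simpa using hq₀
  refine (histExp_le_add_sqrt (q := fun _ => q₀) hp hp1 (fun _ => hq₀) hq' (hn0 D)
    (hnt D)).trans ?_
  have hent : (histExp p (fun _ => q₀) t fun h => ∑ s,
      ((q₀ + if C D (h s).1 then ε else 0) - q₀) ^ 2 / ((q₀ + if C D (h s).1 then ε else 0) *
        (1 - (q₀ + if C D (h s).1 then ε else 0)))) ≤ ε ^ 2 / η * (t * ρ) := by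
    refine (histExp_mono (G := fun h => ε ^ 2 / η * n D h) hp hIcc fun h => ?_).trans ?_
    · simp only [n]
      rw [Finset.mul_sum]
      refine Finset.sum_le_sum fun s _ => ?_
      split_ifs
      · rw [mul_one, add_sub_cancel_left]
        gcongr
      · simp
    · rw [histExp_const_mul]
      gcongr
  have := mul_le_mul_of_nonneg_left (Real.sqrt_le_sqrt hent)
    (mul_nonneg t.cast_nonneg zero_le_two : (0 : ℝ) ≤ t * 2)
  linarith

end History

/-! ### Stationary adversaries -/

/-- The weights of the actions under a policy. -/
noncomputable def Policy.weight {N K : ℕ} (π : Policy N K) (t : ℕ) (h : ObsHistory N K t)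
    (S : Action N K) : ℝ :=
  (π.act t h).real {S}

lemma Policy.weight_nonneg {N K : ℕ} (π : Policy N K) (t : ℕ) (h : ObsHistory N K t)
    (S : Action N K) : 0 ≤ π.weight t h S := measureReal_nonneg

lemma Policy.sum_weight {N K : ℕ} (π : Policy N K) (t : ℕ) (h : ObsHistory N K t) :
    ∑ S, π.weight t h S = 1 := by
  simp [Policy.weight]

/-- The adversary that draws the hidden vectors independently from the law `μ`. -/
noncomputable def Adversary.iid {N : ℕ} (K : ℕ) (μ : Measure (RewardVector N))
    [IsProbabilityMeasure μ] : Adversary N K where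
  choose _ := Kernel.const _ μ
  isMarkov _ := inferInstance

namespace LinkFunction

variable {K N : ℕ} (g : LinkFunction K) (π : Policy N K)

/-- The expected mean reward of an action when the hidden vector has law `μ`. -/
noncomputable def meanReward (μ : Measure (RewardVector N)) (S : Action N K) : ℝ :=
  ∫ v, (g.reward S v : ℝ) ∂μ

lemma measurable_reward_coe (S : Action N K) : Measurable fun v => (g.reward S v : ℝ) :=
  measurable_subtype_coe.comp (g.measurable_reward S)

lemma measurable_uncurry_reward :
    Measurable fun x : RewardVector N × Action N K => (g.reward x.2 x.1 : ℝ) :=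
  measurable_from_prod_countable_left fun S => g.measurable_reward_coe S

lemma reward_bound (S : Action N K) (v : RewardVector N) : ‖(g.reward S v : ℝ)‖ ≤ 1 := by
  rw [Real.norm_eq_abs, abs_of_nonneg (g.reward S v).2.1]
  exact (g.reward S v).2.2

lemma integrable_reward (μ : Measure (RewardVector N)) [IsFiniteMeasure μ] (S : Action N K) :
    Integrable (fun v => (g.reward S v : ℝ)) μ :=
  Integrable.of_bound (g.measurable_reward_coe S).aestronglyMeasurable 1
    (Filter.Eventually.of_forall (g.reward_bound S))

lemma integral_feedback (x : RewardVector N × Action N K) (f : Bool → ℝ) :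
    ∫ r, f r ∂(g.feedback N x) = ∑ r, bernWeight (g.reward x.2 x.1) r * f r := by
  change ∫ r, f r ∂(bernoulliMeasure true false (g.reward x.2 x.1)) = _
  rw [integral_bernoulliMeasure]
  simp [bernWeight]

variable (μ : Measure (RewardVector N)) [IsProbabilityMeasure μ]

lemma integral_roundKernel_iid {t : ℕ} (h : History N K t) {f : Round N K → ℝ}
    (hf : Measurable f) {B : ℝ} (hB : ∀ x, ‖f x‖ ≤ B) :
    ∫ x, f x ∂(g.roundKernel π (Adversary.iid K μ) t h)
      = ∑ S, π.weight t h.obs S *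
          ∫ v, ∑ r, bernWeight (g.reward S v) r * f (v, (S, r)) ∂μ := by
  have hmap : Measurable
      fun x : (RewardVector N × Action N K) × Bool => (x.1.1, (x.1.2, x.2)) := by fun_prop
  have hfmap : Integrable
      (fun x : (RewardVector N × Action N K) × Bool => f (x.1.1, (x.1.2, x.2)))
      (((((Adversary.iid K μ).choose t) ×ₖ (π.act t).comap History.obs History.measurable_obs) ⊗ₖ
        (g.feedback N).prodMkLeft (History N K t)) h) :=
    Integrable.of_bound (hf.comp hmap).aestronglyMeasurable B
      (Filter.Eventually.of_forall fun _ => hB _)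
  rw [roundKernel, Kernel.map_apply _ hmap, integral_map hmap.aemeasurable hf.aestronglyMeasurable,
    ProbabilityTheory.integral_compProd hfmap]
  simp only [Kernel.prodMkLeft_apply, integral_feedback]
  have hint : Integrable (fun x : RewardVector N × Action N K =>
      ∑ r, bernWeight (g.reward x.2 x.1) r * f (x.1, (x.2, r)))
      (μ.prod (π.act t h.obs)) := by
    refine integrable_finsetSum _ fun r _ => ?_
    refine Integrable.of_bound (C := 1 * B) (Measurable.aestronglyMeasurable ?_)
      (Filter.Eventually.of_forall fun x => ?_)
    · refine Measurable.mul ?_ (hf.comp (by fun_prop))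
      cases r
      · exact measurable_const.sub g.measurable_uncurry_reward
      · exact g.measurable_uncurry_reward
    · rw [norm_mul]
      refine mul_le_mul ?_ (hB _) (norm_nonneg _) zero_le_one
      have h0 := (g.reward x.2 x.1).2.1
      have h1 := (g.reward x.2 x.1).2.2
      rw [Real.norm_eq_abs, abs_of_nonneg (bernWeight_nonneg ⟨h0, h1⟩ r)]
      cases r
      · simpa using h0
      · simpa using h1
  rw [Kernel.prod_apply, Kernel.comap_apply]
  change ∫ x, _ ∂(μ.prod (π.act t h.obs)) = _
  rw [integral_prod_symm _ hint, integral_fintype (Integrable.of_finite)]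
  simp [Policy.weight]

lemma integral_law_succ (A : Adversary N K) (t : ℕ) {F : History N K (t + 1) → ℝ}
    (hF : Measurable F) {B : ℝ} (hB : ∀ x, ‖F x‖ ≤ B) :
    ∫ h, F h ∂(g.law π A (t + 1))
      = ∫ h, ∫ x, F (Fin.snoc h x : History N K (t + 1)) ∂(g.roundKernel π A t h)
          ∂(g.law π A t) := by
  have hint : Integrable
      (fun x : History N K t × Round N K => F (Fin.snoc x.1 x.2 : History N K (t + 1)))
      (g.law π A t ⊗ₘ g.roundKernel π A t) :=
    Integrable.of_bound (hF.comp (measurable_snoc t)).aestronglyMeasurable B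
      (Filter.Eventually.of_forall fun _ => hB _)
  rw [law, integral_map (measurable_snoc t).aemeasurable hF.aestronglyMeasurable,
    Measure.integral_compProd hint]

lemma integral_bernWeight_reward (S : Action N K) (r : Bool) :
    ∫ v, bernWeight (g.reward S v) r ∂μ = bernWeight (g.meanReward μ S) r := by
  cases r
  · simp only [bernWeight_false, meanReward]
    rw [integral_sub (integrable_const _) (g.integrable_reward μ S)]
    simp
  · simp [meanReward]

lemma integrable_bernWeight_reward (S : Action N K) (r : Bool) :
    Integrable (fun v => bernWeight (g.reward S v) r) μ := by
  cases r
  · exact (integrable_const _).sub (g.integrable_reward μ S)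
  · exact g.integrable_reward μ S

/-- Against a stationary adversary the learner faces a Bernoulli bandit with the mean rewards as
mean feedbacks. -/
lemma integral_law_iid_obs (t : ℕ) (G : ObsHistory N K t → ℝ) :
    ∫ h, G h.obs ∂(g.law π (Adversary.iid K μ) t)
      = histExp π.weight (g.meanReward μ) t G := by
  induction t with
  | zero =>
    rw [integral_congr_ae (g := fun _ => G Fin.elim0)
      (Filter.Eventually.of_forall fun h => congrArg G (Subsingleton.elim _ _))]
    simp [histExp, histWeight, Subsingleton.elim default (Fin.elim0 : ObsHistory N K 0)]
  | succ t ih =>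
    obtain ⟨B, hB⟩ : ∃ B, ∀ h, ‖G h‖ ≤ B := by
      obtain ⟨B, hB⟩ := (Set.finite_range fun h => ‖G h‖).bddAbove
      exact ⟨B, fun h => hB ⟨h, rfl⟩⟩
    have hG : Measurable G := measurable_of_finite G
    rw [integral_law_succ g π _ t (F := fun h => G h.obs) (hG.comp History.measurable_obs)
      fun h => hB _, histExp_succ, ← ih]
    congr 1
    funext h
    have hsnoc : ∀ x : Round N K, History.obs (Fin.snoc h x : History N K (t + 1))
        = (Fin.snoc h.obs x.2 : ObsHistory N K (t + 1)) := fun x => by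
      funext s
      refine Fin.lastCases ?_ (fun s => ?_) s <;> simp [History.obs]
    simp only [hsnoc]
    rw [integral_roundKernel_iid g π μ h (f := fun x =>
      G (Fin.snoc h.obs x.2 : ObsHistory N K (t + 1)))
      ((measurable_of_finite fun y => G (Fin.snoc h.obs y : ObsHistory N K (t + 1))).comp
        measurable_snd) fun _ => hB _]
    refine Finset.sum_congr rfl fun S _ => ?_
    dsimp only
    rw [integral_finsetSum _ fun r _ => (g.integrable_bernWeight_reward μ S r).mul_const _]
    simp only [integral_mul_const, integral_bernWeight_reward]

lemma integral_law_sum_succ (A : Adversary N K) (t : ℕ) {f : Round N K → ℝ} (hf : Measurable f)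
    {B : ℝ} (hB : ∀ x, ‖f x‖ ≤ B) :
    ∫ h, ∑ s, f (h s) ∂(g.law π A (t + 1))
      = ∫ h, ∑ s, f (h s) ∂(g.law π A t)
        + ∫ h, ∫ x, f x ∂(g.roundKernel π A t h) ∂(g.law π A t) := by
  have hsum : ∀ t, Measurable fun h : History N K t => ∑ s, f (h s) := fun t =>
    Finset.measurable_fun_sum _ fun s _ => hf.comp (measurable_pi_apply s)
  have hsumB : ∀ (t : ℕ) (h : History N K t), ‖∑ s, f (h s)‖ ≤ ∑ _s : Fin t, B := fun t h =>
    (norm_sum_le _ _).trans (Finset.sum_le_sum fun s _ => hB _)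
  have hround : Integrable (fun h => ∫ x, f x ∂(g.roundKernel π A t h)) (g.law π A t) :=
    Integrable.of_bound hf.stronglyMeasurable.integral_kernel.aestronglyMeasurable B
      (Filter.Eventually.of_forall fun h => by
        simpa using norm_integral_le_of_norm_le_const (μ := g.roundKernel π A t h)
          (Filter.Eventually.of_forall hB))
  rw [integral_law_succ g π A t (F := fun h => ∑ s, f (h s)) (hsum _) (hsumB _), ← integral_add
    (Integrable.of_bound (hsum t).aestronglyMeasurable _ (Filter.Eventually.of_forall (hsumB t)))
    hround]
  congr 1
  funext h
  simp only [Fin.sum_univ_castSucc, Fin.snoc_castSucc, Fin.snoc_last]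
  rw [integral_add (integrable_const _)
    (Integrable.of_bound hf.aestronglyMeasurable B (Filter.Eventually.of_forall hB))]
  simp

lemma expectedRegret_iid (T : ℕ) (Sstar : Action N K) :
    g.expectedRegret T π (Adversary.iid K μ) Sstar
      = histExp π.weight (g.meanReward μ) T fun h =>
          ∑ s, (g.meanReward μ Sstar - g.meanReward μ (h s).1) := by
  let f : Round N K → ℝ := fun x => (g.reward Sstar x.1 : ℝ) - g.reward x.2.1 x.1
  let f' : Round N K → ℝ := fun x => g.meanReward μ Sstar - g.meanReward μ x.2.1
  have hf : Measurable f := ((g.measurable_reward_coe Sstar).comp measurable_fst).sub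
    (g.measurable_uncurry_reward.comp (by fun_prop :
      Measurable fun x : Round N K => (x.1, x.2.1)))
  have hf' : Measurable f' := (measurable_of_finite fun y : Observation N K =>
    g.meanReward μ Sstar - g.meanReward μ y.1).comp measurable_snd
  have hB : ∀ x, ‖f x‖ ≤ 1 + 1 := fun x =>
    (norm_sub_le _ _).trans (add_le_add (g.reward_bound _ _) (g.reward_bound _ _))
  have hmean : ∀ S : Action N K, ‖g.meanReward μ S‖ ≤ 1 := fun S => by
    simpa [meanReward] using norm_integral_le_of_norm_le_const (μ := μ)
      (Filter.Eventually.of_forall (g.reward_bound S))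
  have hB' : ∀ x, ‖f' x‖ ≤ 1 + 1 := fun x =>
    (norm_sub_le _ _).trans (add_le_add (hmean _) (hmean _))
  rw [expectedRegret, ← integral_law_iid_obs]
  change ∫ h : History N K T, ∑ s, f (h s) ∂_ = ∫ h : History N K T, ∑ s, f' (h s) ∂_
  induction T with
  | zero => simp
  | succ t ih =>
    rw [integral_law_sum_succ g π _ t hf hB, integral_law_sum_succ g π _ t hf' hB', ih]
    congr 2
    funext h
    rw [integral_roundKernel_iid g π μ h hf hB, integral_roundKernel_iid g π μ h hf' hB']
    refine Finset.sum_congr rfl fun S _ => congrArg _ ?_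
    simp only [← Finset.sum_mul, sum_bernWeight, one_mul, f, f']
    rw [integral_sub (g.integrable_reward μ _) (g.integrable_reward μ _)]
    simp [meanReward]

end LinkFunction

/-! ### The hard instances -/

section Instance

variable {N : ℕ}

/-- The hidden vector whose arms have value `b` or `a` according to the bits of `x`. -/
def cubeVector (a b : unitInterval) (x : Fin N → Bool) : RewardVector N := fun i => cond (x i) b a

lemma coe_cubeVector (a b : unitInterval) (x : Fin N → Bool) (i : Fin N) :
    (cubeVector a b x i : ℝ) = bitValue a b (x i) := by
  unfold cubeVector bitValue
  cases x i <;> rfl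

/-- The law of a hidden vector with values in `{a, b}` whose bits are fair and independent, except
that the parity of the bits in `D` has bias `δ`. -/
noncomputable def parityLaw (a b : unitInterval) (D : Finset (Fin N)) (δ : ℝ) :
    Measure (RewardVector N) :=
  ∑ x : Fin N → Bool, ENNReal.ofReal ((1 + δ * ∏ i ∈ D, bitSign (x i)) / 2 ^ N) •
    Measure.dirac (cubeVector a b x)

variable {D : Finset (Fin N)} {δ : ℝ}

lemma parity_density_nonneg (hδ : |δ| ≤ 1) (x : Fin N → Bool) :
    0 ≤ 1 + δ * ∏ i ∈ D, bitSign (x i) := by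
  have : |δ * ∏ i ∈ D, bitSign (x i)| ≤ 1 := by rwa [abs_mul, abs_prod_bitSign, mul_one]
  linarith [(abs_le.1 this).1]

lemma integral_parityLaw (a b : unitInterval) (hδ : |δ| ≤ 1) (f : RewardVector N → ℝ) :
    ∫ v, f v ∂(parityLaw a b D δ)
      = cubeAvg fun x => (1 + δ * ∏ i ∈ D, bitSign (x i)) * f (cubeVector a b x) := by
  rw [parityLaw, integral_finsetSum_measure fun x _ =>
    (integrable_dirac (by simp)).smul_measure ENNReal.ofReal_ne_top]
  simp only [integral_smul_measure, integral_dirac, cubeAvg, Finset.sum_div, Fintype.card_fin]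
  refine Finset.sum_congr rfl fun x _ => ?_
  rw [ENNReal.toReal_ofReal (div_nonneg (parity_density_nonneg hδ x) (by positivity)), smul_eq_mul]
  ring

lemma isProbabilityMeasure_parityLaw (a b : unitInterval) (hD : D.Nonempty) (hδ : |δ| ≤ 1) :
    IsProbabilityMeasure (parityLaw a b D δ) := by
  have hfin : IsFiniteMeasure (parityLaw a b D δ) := by
    unfold parityLaw
    have : ∀ x : Fin N → Bool, IsFiniteMeasure
        (ENNReal.ofReal ((1 + δ * ∏ i ∈ D, bitSign (x i)) / 2 ^ N) •
          Measure.dirac (cubeVector a b x)) := fun x =>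
      Measure.smul_finite _ ENNReal.ofReal_ne_top
    infer_instance
  have h1 := integral_parityLaw (D := D) a b hδ fun _ => 1
  have h0 := cubeAvg_parity_mul_eq_zero (S := ∅) a b
    (fun h => hD.ne_empty (Finset.subset_empty.1 h)) fun _ => 1
  simp only [mul_one] at h0 h1
  rw [cubeAvg_add, cubeAvg_const, cubeAvg_const_mul, h0, mul_zero, add_zero] at h1
  refine ⟨?_⟩
  rw [integral_const, smul_eq_mul, mul_one] at h1
  rw [← ENNReal.toReal_eq_one_iff]
  exact h1

/-- Under `parityLaw` the mean reward of an action does not reveal anything about `D` unless the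
action contains `D`. -/
lemma LinkFunction.meanReward_parityLaw {K : ℕ} (g : LinkFunction K) {F : ℝ → ℝ}
    (hF : ∀ x ∈ Set.Icc (0 : ℝ) K, g.toFun x = F x) (a b : unitInterval) (hδ : |δ| ≤ 1)
    (S : Action N K) :
    g.meanReward (parityLaw a b D δ) S = (avgOp a b)^[K] F 0
      + if D ⊆ S.1 then δ * (avgOp a b)^[K - D.card] ((diffOp a b)^[D.card] F) 0 else 0 := by
  have hreward : ∀ x : Fin N → Bool,
      (g.reward S (cubeVector a b x) : ℝ) = F (∑ i ∈ S.1, bitValue a b (x i)) := fun x => by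
    change g.toFun _ = _
    rw [hF _ (sum_mem S _)]
    simp only [coe_cubeVector]
  rw [meanReward, integral_parityLaw a b hδ]
  simp only [hreward, add_mul, one_mul, mul_assoc]
  rw [cubeAvg_add, cubeAvg_const_mul]
  congr 1
  · have := cubeAvg_sum_bitValue (a : ℝ) b S.1 F 0
    simpa [S.2] using this
  · split_ifs with hDS
    · have := cubeAvg_parity_mul (a : ℝ) b (Finset.disjoint_sdiff (s := D) (t := S.1)) F 0
      rw [Finset.union_sdiff_of_subset hDS, Finset.card_sdiff_of_subset hDS, S.2] at this
      simpa using congrArg (δ * ·) this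
    · rw [cubeAvg_parity_mul_eq_zero _ _ hDS, mul_zero]

end Instance

/-! ### Counting -/

lemma sum_subset_indicator {N K d : ℕ} (S : Action N K) :
    ∑ D : Action N d, (if D.1 ⊆ S.1 then (1 : ℝ) else 0) = K.choose d := by
  rw [← Finset.sum_subtype (Finset.powersetCard d Finset.univ) (fun D => by simp)
    fun D => if D ⊆ S.1 then (1 : ℝ) else 0, Finset.sum_boole]
  have : (Finset.powersetCard d Finset.univ).filter (· ⊆ S.1) = Finset.powersetCard d S.1 := by
    ext D
    simp [and_comm]
  rw [this, Finset.card_powersetCard, S.2]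

lemma choose_mul_succ_le {N K d : ℕ} (hd : 1 ≤ d) (hKN : K < N) :
    K.choose d * (K + 1) ≤ K * N.choose d := by
  rw [Nat.choose_mul_succ_eq, mul_comm]
  exact Nat.mul_le_mul (by omega) (Nat.choose_le_choose d hKN)

lemma pow_le_mul_choose {N d : ℕ} (hd : 1 ≤ d) (hdN : d ≤ N) :
    N ^ d ≤ d ^ d * d.factorial * N.choose d := by
  have h1 : N ≤ d * (N + 1 - d) := by
    obtain ⟨k, rfl⟩ := Nat.exists_eq_add_of_le hdN
    rw [show d + k + 1 - d = k + 1 by omega]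
    nlinarith
  calc N ^ d ≤ (d * (N + 1 - d)) ^ d := Nat.pow_le_pow_left h1 d
    _ = d ^ d * (N + 1 - d) ^ d := mul_pow _ _ _
    _ ≤ d ^ d * N.descFactorial d := Nat.mul_le_mul_left _ (Nat.pow_sub_le_descFactorial N d)
    _ = _ := by rw [Nat.descFactorial_eq_factorial_mul_choose, mul_assoc]

/-! ### The lower bound -/

/-- The regret of every policy against the worst parity law. Here `F` is any function that agrees
with `g` on `[0, K]`, and `Γ ≠ 0` is the effect of a parity bias on the mean reward of the actions
that contain the hidden set. -/
lemma LinkFunction.exists_le_minimaxRegret {K d : ℕ} (hd : 1 ≤ d) (hdK : d ≤ K)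
    (g : LinkFunction K) {F : ℝ → ℝ} (hF : ∀ x ∈ Set.Icc (0 : ℝ) K, g.toFun x = F x)
    (a b : unitInterval) (hΓ : (avgOp a b)^[K - d] ((diffOp a b)^[d] F) 0 ≠ 0) :
    ∃ c : ℝ, 0 < c ∧ ∀ N T : ℕ, K < N → 1 ≤ T →
      ((c * min (T : ℝ) (Real.sqrt ((N : ℝ) ^ d * T)) : ℝ) : EReal) ≤ g.minimaxRegret N T := by
  set Γ := (avgOp a b)^[K - d] ((diffOp a b)^[d] F) 0 with hΓdef
  set q₀ := (avgOp a b)^[K] F 0 with hq₀def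
  let L : ℝ := d ^ d * d.factorial * K.choose d
  have hchooseK : (0 : ℝ) < K.choose d := by exact_mod_cast Nat.choose_pos hdK
  have hd0 : (0 : ℝ) < d := by exact_mod_cast hd
  have hL : 0 < L := by positivity
  have hΓ0 : 0 < |Γ| := abs_pos.2 hΓ
  refine ⟨|Γ| / (16 * (K + 1) ^ 2) / √L, by positivity, fun N T hKN hT => ?_⟩
  have hT0 : (0 : ℝ) < T := by exact_mod_cast hT
  have hchooseN : (0 : ℝ) < N.choose d := by exact_mod_cast Nat.choose_pos (hdK.trans hKN.le)
  have hmean : ∀ (D : Action N d) (δ : ℝ), |δ| ≤ 1 → ∀ S : Action N K,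
      g.meanReward (parityLaw a b D.1 δ) S = q₀ + if D.1 ⊆ S.1 then δ * Γ else 0 :=
    fun D δ hδ S => by
      have := g.meanReward_parityLaw (D := D.1) hF a b hδ S
      rwa [D.2] at this
  have hnonempty : ∀ D : Action N d, D.1.Nonempty := fun D =>
    Finset.card_pos.1 (by rw [D.2]; exact hd)
  have hsuper : ∀ D : Action N d, ∃ S : Action N K, D.1 ⊆ S.1 := fun D => by
    obtain ⟨S, hDS, hS⟩ := Finset.exists_superset_card_eq (s := D.1) (n := K)
      (by rw [D.2]; exact hdK) (by simpa using hKN.le)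
    exact ⟨⟨S, hS⟩, hDS⟩
  have hne : Nonempty (Action N d) := by
    obtain ⟨D, -, hD⟩ := Finset.exists_superset_card_eq (s := (∅ : Finset (Fin N))) (n := d)
      (by simp) (by simpa using hdK.trans hKN.le)
    exact ⟨⟨D, hD⟩⟩
  -- the extreme biases `±1` still give mean rewards in `[0, 1]`
  have hunit : ∀ δ : ℝ, |δ| ≤ 1 → q₀ + δ * Γ ∈ Set.Icc (0 : ℝ) 1 := fun δ hδ => by
    obtain ⟨D⟩ := hne
    obtain ⟨S, hDS⟩ := hsuper D
    have := isProbabilityMeasure_parityLaw a b (hnonempty D) hδ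
    have hm := hmean D δ hδ S
    rw [if_pos hDS] at hm
    rw [← hm]
    refine ⟨integral_nonneg fun v => (g.reward S v).2.1, ?_⟩
    simpa [meanReward] using integral_mono
      (g.integrable_reward (parityLaw a b D.1 δ) S) (integrable_const (1 : ℝ))
      fun v => (g.reward S v).2.2
  have hplus := hunit 1 (by simp)
  have hminus := hunit (-1) (by simp)
  have hq₀Γ : |Γ| ≤ q₀ ∧ |Γ| ≤ 1 - q₀ := by
    constructor <;> refine abs_le.2 ⟨?_, ?_⟩ <;> linarith [hplus.1, hplus.2, hminus.1, hminus.2]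
  -- `ρ` is the fraction of the `d`-sets that are covered by one action
  let ρ : ℝ := K.choose d / N.choose d
  have hρ0 : 0 < ρ := by positivity
  have hρ1 : ρ ≤ 1 - 1 / (K + 1) := by
    have : ((K.choose d : ℝ) * (K + 1)) ≤ K * N.choose d := by
      exact_mod_cast choose_mul_succ_le hd hKN
    rw [div_le_iff₀ hchooseN, ← sub_nonneg]
    have h2 : (1 - 1 / ((K : ℝ) + 1)) * N.choose d - K.choose d
        = (K * N.choose d - K.choose d * (K + 1)) / (K + 1) := by
      field_simp
      ring
    rw [h2]
    exact div_nonneg (by linarith) (by positivity)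
  have hρL : (N : ℝ) ^ d ≤ L / ρ := by
    have : (N : ℝ) ^ d ≤ d ^ d * d.factorial * N.choose d := by
      exact_mod_cast pow_le_mul_choose hd (hdK.trans hKN.le)
    refine this.trans_eq ?_
    simp only [L, ρ]
    field_simp
  -- up to a constant, the largest gap that the policy cannot detect in `T` rounds; the factor
  -- `8 * (K + 1)` makes the loss from the change of measure at most half of the slack in `hρ1`
  let ε : ℝ := |Γ| / (8 * (K + 1)) * min 1 (√(T * ρ))⁻¹
  have hsq : 0 < √(T * ρ) := Real.sqrt_pos.2 (by positivity)
  have hε0 : 0 < ε := by positivity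
  have hεΓ : ε ≤ |Γ| / 2 := by
    have h1 : |Γ| / (8 * (K + 1)) ≤ |Γ| / 2 :=
      div_le_div_of_nonneg_left hΓ0.le two_pos (by linarith [(Nat.cast_nonneg K : (0 : ℝ) ≤ K)])
    calc ε ≤ |Γ| / (8 * (K + 1)) * 1 :=
          mul_le_mul_of_nonneg_left (min_le_left _ _) (by positivity)
      _ ≤ |Γ| / 2 := by rwa [mul_one]
  have hδ : |ε / Γ| ≤ 1 := by
    rw [abs_div, abs_of_pos hε0, div_le_one hΓ0]
    linarith
  have hδΓ : ε / Γ * Γ = ε := div_mul_cancel₀ _ hΓ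
  refine le_iInf fun π => ?_
  obtain ⟨D, hD⟩ := exists_histExp_count_le (p := π.weight) (q₀ := q₀) (ε := ε)
    (η := (|Γ| / 2) ^ 2) (ρ := ρ) (fun (D : Action N d) (S : Action N K) => D.1 ⊆ S.1)
    π.weight_nonneg π.sum_weight ⟨by linarith, by linarith⟩ ⟨by linarith, by linarith⟩
    (by positivity) (by nlinarith) (fun S => by
      rw [sum_subset_indicator, Fintype.card_finset_len, Fintype.card_fin,
        div_mul_cancel₀ _ hchooseN.ne']) T
  obtain ⟨S, hDS⟩ := hsuper D
  have hprob := isProbabilityMeasure_parityLaw a b (hnonempty D) hδ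
  refine le_iSup₂_of_le (Adversary.iid K (parityLaw a b D.1 (ε / Γ))) S ?_
  rw [EReal.coe_le_coe_iff, expectedRegret_iid]
  have hq : g.meanReward (parityLaw a b D.1 (ε / Γ))
      = fun S : Action N K => q₀ + if D.1 ⊆ S.1 then ε else 0 := by
    funext S
    rw [hmean D _ hδ, hδΓ]
  have hregret : ∀ h : ObsHistory N K T,
      ∑ s, ((q₀ + if D.1 ⊆ S.1 then ε else 0) - (q₀ + if D.1 ⊆ (h s).1.1 then ε else 0))
        = ε * T + -ε * ∑ s, if D.1 ⊆ (h s).1.1 then (1 : ℝ) else 0 := fun h => by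
    have : ∀ s, ((q₀ + if D.1 ⊆ S.1 then ε else 0) - (q₀ + if D.1 ⊆ (h s).1.1 then ε else 0))
        = ε + -ε * if D.1 ⊆ (h s).1.1 then (1 : ℝ) else 0 := fun s => by
      rw [if_pos hDS]
      split_ifs <;> ring
    simp only [this, Finset.sum_add_distrib, ← Finset.mul_sum]
    simp [mul_comm]
  rw [hq]
  simp only [hregret]
  rw [histExp_add, histExp_const π.sum_weight, histExp_const_mul]
  have hsqrt : √(ε ^ 2 / (|Γ| / 2) ^ 2 * (T * ρ)) ≤ 1 / (4 * (K + 1)) := by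
    rw [← div_pow, Real.sqrt_mul (sq_nonneg _), Real.sqrt_sq (by positivity)]
    have : ε ≤ |Γ| / (8 * (K + 1)) * (√(T * ρ))⁻¹ :=
      mul_le_mul_of_nonneg_left (min_le_right _ _) (by positivity)
    calc ε / (|Γ| / 2) * √(T * ρ)
        ≤ |Γ| / (8 * (K + 1)) * (√(T * ρ))⁻¹ / (|Γ| / 2) * √(T * ρ) := by gcongr
      _ = 1 / (4 * (K + 1)) := by
        field_simp
        ring
  have hcount : histExp π.weight (fun S : Action N K => q₀ + if D.1 ⊆ S.1 then ε else 0) T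
      (fun h => ∑ s, if D.1 ⊆ (h s).1.1 then (1 : ℝ) else 0) ≤ T * (1 - 1 / (2 * (K + 1))) := by
    refine hD.trans (mul_le_mul_of_nonneg_left ?_ hT0.le)
    have e1 : (1 : ℝ) / (K + 1) = 4 * (1 / (4 * (K + 1))) := by field_simp
    have e2 : (1 : ℝ) / (2 * (K + 1)) = 2 * (1 / (4 * (K + 1))) := by field_simp; norm_num
    linarith
  have hmin : min (T : ℝ) √(N ^ d * T) / √L ≤ T * min 1 (√(T * ρ))⁻¹ := by
    rw [mul_min_of_nonneg _ _ hT0.le, mul_one]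
    refine le_min ?_ ?_
    · have hL1 : 1 ≤ L := by
        have : 1 ≤ d ^ d * d.factorial * K.choose d :=
          Nat.mul_pos (Nat.mul_pos (pow_pos hd d) d.factorial_pos) (Nat.choose_pos hdK)
        simp only [L]
        exact_mod_cast this
      exact (div_le_self (by positivity) (Real.one_le_sqrt.2 hL1)).trans (min_le_left _ _)
    · calc min (T : ℝ) √(N ^ d * T) / √L ≤ √(N ^ d * T) / √L := by
            gcongr
            exact min_le_right _ _
        _ = √(N ^ d * T / L) := (Real.sqrt_div (by positivity) _).symm
        _ ≤ √(T ^ 2 / (T * ρ)) := by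
            refine Real.sqrt_le_sqrt ?_
            calc (N : ℝ) ^ d * T / L ≤ L / ρ * T / L := by gcongr
              _ = T ^ 2 / (T * ρ) := by field_simp
        _ = T * (√(T * ρ))⁻¹ := by
            rw [Real.sqrt_div (by positivity), Real.sqrt_sq hT0.le, div_eq_mul_inv]
  calc |Γ| / (16 * (K + 1) ^ 2) / √L * min (T : ℝ) √(N ^ d * T)
      = |Γ| / (16 * (K + 1) ^ 2) * (min (T : ℝ) √(N ^ d * T) / √L) := by ring
    _ ≤ |Γ| / (16 * (K + 1) ^ 2) * (T * min 1 (√(T * ρ))⁻¹) := by gcongr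
    _ = ε * (T * (1 / (2 * (K + 1)))) := by
        simp only [ε]
        field_simp
        ring
    _ ≤ ε * T + -ε * _ := by
        have := mul_le_mul_of_nonneg_left hcount hε0.le
        linarith

end CombBandit

theorem lemma4 (K : ℕ) (hK : 1 ≤ K) (g : CombBandit.LinkFunction K) :
    (∀ d : ℕ, 1 ≤ d → d < K → CombBandit.IsPolynomialOfDegree g.toFun K d →
      ∃ c : ℝ, 0 < c ∧ ∀ N T : ℕ, K < N → 1 ≤ T →
        ((c * min (T : ℝ) (Real.sqrt ((N : ℝ) ^ d * T)) : ℝ) : EReal) ≤ g.minimaxRegret N T) ∧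
    ((¬ ∃ p : Polynomial ℝ, p.degree < K ∧ ∀ x ∈ Set.Icc (0 : ℝ) K, g.toFun x = p.eval x) →
      ∃ c : ℝ, 0 < c ∧ ∀ N T : ℕ, K < N → 1 ≤ T →
        ((c * min (T : ℝ) (Real.sqrt ((N : ℝ) ^ K * T)) : ℝ) : EReal) ≤ g.minimaxRegret N T) := by
  refine ⟨fun d hd hdK ⟨p, hp, hgp⟩ => ?_, fun hg => ?_⟩
  · exact g.exists_le_minimaxRegret hd hdK.le hgp 0 1
      (CombBandit.avgOp_diffOp_polynomial_ne_zero hp (K - d))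
  · obtain ⟨a, b, hab⟩ := g.exists_diffOp_ne_zero hK hg
    exact g.exists_le_minimaxRegret hK le_rfl (fun _ _ => rfl) a b (by simpa using hab)
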